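/- Let $\alpha>0$. For $p\in[0,1]$ put $s_1(p)=-p\log p-(1-p)\log(1-p)$ (with $0\log 0=0$) and $s_\alpha(p)=\frac{1}{1-\alpha}\left(p^\alpha+(1-p)^\alpha-1\right)$ for $\alpha\neq1$. Let $\Delta^n=\{(p_0,\dots,p_n)\in[0,1]^{n+1} : \sum_i p_i=1\}$. "Measurable" means Lebesgue measurable (in particular, Borel measurable functions are covered), where $\Delta^1$ is identified with $[0,1]$ by $x\mapsto(x,1-x)$. (1) Let $f_1,f_2:\Delta^1\to\mathbb R$ be measurable functions with $f_i(0,1)=f_i(1,0)=0$ for $i=1,2$, such that for all $(p_0,p_1,p_2)\in\Delta^2$ $$(1-p_2)^\alpha f_1\left(\tfrac{p_0}{1-p_2},\tfrac{p_1}{1-p_2}\right)-f_1(1-p_1,p_1)=(1-p_1)^\alpha f_2\left(\tfrac{p_0}{1-p_1},\tfrac{p_2}{1-p_1}\right)-f_2(1-p_2,p_2),$$ where, by convention, a term $(1-p_k)^\alpha f_i(\cdot,\cdot)$ is $0$ when $p_k=1$. Then $f_1=f_2$, and there is $\lambda\in\mathbb R$ such that $f_1(p,1-p)=\lambda s_\alpha(p)$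 for all $p\in[0,1]$. For functions $u:[0,1]\to\mathbb R$, consider the $\alpha$-fundamental equation $$u(1-x)+(1-x)^\alpha u\left(\tfrac{y}{1-x}\right)=u(y)+(1-y)^\alpha u\left(\tfrac{1-x-y}{1-y}\right)\qquad\text{for all }x,y\in[0,1)\text{ with }x+y\le1.\tag{E}$$ (2) The measurable solutions $u$ of (E) with $u(0)=u(1)=0$ are exactly the functions $\lambda s_\alpha$, $\lambda\in\mathbb R$. (3) (Regularity) Every measurable solution of (E) is infinitely differentiable on $(0,1)$. (4) (Symmetry) Every solution of (E), measurable or not, satisfies $u(x)=u(1-x)$ for all $x\in\mathbb Q\cap[0,1]$. -/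

import Mathlib

open Set MeasureTheory
open scoped ContDiff

noncomputable section

/-- The binary `α`-entropy `s_α`: Shannon's for `α = 1` (with `0 log 0 = 0`), and the
structural (Tsallis) one for `α ≠ 1`. It is used on `[0,1]`, with `0 < α`. -/
def binaryEntropy (α p : ℝ) : ℝ :=
  if α = 1 then -p * Real.log p - (1 - p) * Real.log (1 - p)
  else 1 / (1 - α) * (p ^ α + (1 - p) ^ α - 1)

/-- The point `(x, y)` of the `1`-simplex. -/
def simplexPair (x y : ℝ) (hx : 0 ≤ x) (hy : 0 ≤ y) (hxy : x + y = 1) :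
    stdSimplex ℝ (Fin 2) :=
  ⟨![x, y], by
    refine ⟨fun i => ?_, by simpa using hxy⟩
    fin_cases i
    · exact hx
    · exact hy⟩

/-- For `p` in the `2`-simplex, and `i, j, k` the three indices, the term
`(1 - p_k)^α f (p_i / (1 - p_k), p_j / (1 - p_k))`, which is `0` by convention when
`p_k = 1`. -/
def twistedTerm (α : ℝ) (f : stdSimplex ℝ (Fin 2) → ℝ) (p : Fin 3 → ℝ)
    (hp : p ∈ stdSimplex ℝ (Fin 3)) (i j k : Fin 3) (hk : p i + p j = 1 - p k) : ℝ :=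
  if h : p k < 1 then
    (1 - p k) ^ α * f (simplexPair (p i / (1 - p k)) (p j / (1 - p k))
      (div_nonneg (hp.1 i) (sub_nonneg.2 h.le)) (div_nonneg (hp.1 j) (sub_nonneg.2 h.le))
      (by rw [← add_div, hk, div_self (sub_pos.2 h).ne']))
  else 0

theorem simplex_le_one {p : Fin 3 → ℝ} (hp : p ∈ stdSimplex ℝ (Fin 3)) (i : Fin 3) :
    p i ≤ 1 :=
  (mem_Icc_of_mem_stdSimplex hp i).2

theorem simplex_sum {p : Fin 3 → ℝ} (hp : p ∈ stdSimplex ℝ (Fin 3)) :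
    p 0 + p 1 + p 2 = 1 := by
  rw [← Fin.sum_univ_three]; exact hp.2

/-- The point `(1 - p_k, p_k)` of the `1`-simplex, for `p` in the `2`-simplex. -/
def binaryMarginal (p : Fin 3 → ℝ) (hp : p ∈ stdSimplex ℝ (Fin 3)) (k : Fin 3) :
    stdSimplex ℝ (Fin 2) :=
  simplexPair (1 - p k) (p k) (sub_nonneg.2 (simplex_le_one hp k)) (hp.1 k)
    (sub_add_cancel 1 (p k))

/-- The `α`-twisted cocycle equation on the `2`-simplex: for all `(p₀, p₁, p₂)`,
`(1-p₂)^α f₁(p₀/(1-p₂), p₁/(1-p₂)) - f₁(1-p₁, p₁)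
  = (1-p₁)^α f₂(p₀/(1-p₁), p₂/(1-p₁)) - f₂(1-p₂, p₂)`. -/
def TwistedCocycle (α : ℝ) (f₁ f₂ : stdSimplex ℝ (Fin 2) → ℝ) : Prop :=
  ∀ (p : Fin 3 → ℝ) (hp : p ∈ stdSimplex ℝ (Fin 3)),
    twistedTerm α f₁ p hp 0 1 2 (by linarith [simplex_sum hp]) - f₁ (binaryMarginal p hp 1) =
    twistedTerm α f₂ p hp 0 2 1 (by linarith [simplex_sum hp]) - f₂ (binaryMarginal p hp 2)

/-- `f` vanishes at the two vertices `(0,1)` and `(1,0)` of the `1`-simplex. -/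
def VanishesAtVertices (f : stdSimplex ℝ (Fin 2) → ℝ) : Prop :=
  f (simplexPair 0 1 le_rfl zero_le_one (zero_add 1)) = 0 ∧
  f (simplexPair 1 0 zero_le_one le_rfl (add_zero 1)) = 0

/-- Lebesgue measurability of a function on the `1`-simplex, identified with `[0,1]` by
`x ↦ (x, 1 - x)`; every Borel function is Lebesgue measurable. -/
def LebesgueMeasurable (f : stdSimplex ℝ (Fin 2) → ℝ) : Prop :=
  AEMeasurable (fun x : unitInterval =>
    f (simplexPair x (1 - x) x.2.1 (sub_nonneg.2 x.2.2) (add_sub_cancel (x : ℝ) 1)))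
    (volume : Measure unitInterval)

/-- The `α`-fundamental equation for a function `u` on `[0,1]`; the values of `u` outside
`[0,1]` are not involved. -/
def FundamentalEquation (α : ℝ) (u : ℝ → ℝ) : Prop :=
  ∀ x y : ℝ, 0 ≤ x → x < 1 → 0 ≤ y → y < 1 → x + y ≤ 1 →
    u (1 - x) + (1 - x) ^ α * u (y / (1 - x)) =
      u y + (1 - y) ^ α * u ((1 - x - y) / (1 - y))

end

/-! Put `F a b = (a + b) ^ α * u (a / (a + b))`. In the variables `a, b, c > 0`, equation (E)
becomes the `2`-cocycle identity for `F`, and `F` is homogeneous of degree `α`.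

Symmetry. The antisymmetrization `F a b - F b a` is additive in each variable, so it vanishes on
positive integers; homogeneity carries this to rationals. If `u` is measurable, `F 1` is locally
bounded (`bounded_on_Icc`), so the antisymmetrization is linear, hence zero.

Classification of symmetric `F`. For `α ≠ 1`, doubling the arguments multiplies `F` by `2 ^ α` but
is cohomologous to multiplying it by `2` (`double`), so `F` is an explicit coboundary. For `α = 1`
this is void: instead, averaging the cocycle identity gives a primitive `K` (`eq_primitive`), and
homogeneity forces `K a / a - K 1` to be a multiple of `log a`. On `a + b = 1` both answers are
entropies.

The system for `f₁, f₂` reduces to (E): the edge `p₀ = 0` gives `f₂ (x) = f₁ (1 - x)`, with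
functions written in the first coordinate. -/

/-! ### Homogeneous cocycles and rational symmetry -/

/-- A `2`-cocycle on the positive reals that is homogeneous of degree `α`. -/
structure HomogeneousCocycle (α : ℝ) (F : ℝ → ℝ → ℝ) : Prop where
  cocycle : ∀ a b c : ℝ, 0 < a → 0 < b → 0 < c → F a b + F (a + b) c = F b c + F a (b + c)
  homogeneous : ∀ t a b : ℝ, 0 < t → 0 < a → 0 < b → F (t * a) (t * b) = t ^ α * F a b

/-- The homogeneous extension of degree `α` of the function `u (x) = F (x, 1 - x)`. -/
noncomputable def homogeneousExtension (α : ℝ) (u : ℝ → ℝ) (a b : ℝ) : ℝ :=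
  (a + b) ^ α * u (a / (a + b))

theorem homogeneousExtension_one_sub (α : ℝ) (u : ℝ → ℝ) (x : ℝ) :
    homogeneousExtension α u x (1 - x) = u x := by
  simp [homogeneousExtension]

theorem FundamentalEquation.map_one {α : ℝ} (hα : 0 < α) {u : ℝ → ℝ}
    (h : FundamentalEquation α u) : u 1 = 0 := by
  have h1 := h 0 (1 / 2) le_rfl one_pos (by norm_num) (by norm_num) (by norm_num)
  have h2 : ((1 : ℝ) / 2) ^ α < 1 := Real.rpow_lt_one (by norm_num) (by norm_num) hα
  norm_num at h1 h2
  have h3 : ((1 / 2) ^ α - 1) * u 1 = 0 := by linear_combination -h1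
  exact (mul_eq_zero.1 h3).resolve_left (sub_ne_zero.2 h2.ne)

theorem FundamentalEquation.map_zero {α : ℝ} (hα : 0 < α) {u : ℝ → ℝ}
    (h : FundamentalEquation α u) : u 0 = 0 := by
  have h1 := h (1 / 2) 0 (by norm_num) (by norm_num) le_rfl one_pos (by norm_num)
  have h2 : ((1 : ℝ) / 2) ^ α < 1 := Real.rpow_lt_one (by norm_num) (by norm_num) hα
  norm_num at h1 h2
  have h3 : ((1 / 2) ^ α - 1) * u 0 = 0 := by linear_combination h1
  exact (mul_eq_zero.1 h3).resolve_left (sub_ne_zero.2 h2.ne)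

/-- The cocycle identity is (E) at `x = c / T`, `y = a / T` with `T = a + b + c`, multiplied by `T ^
α`. -/
theorem FundamentalEquation.homogeneousCocycle {α : ℝ} {u : ℝ → ℝ}
    (h : FundamentalEquation α u) : HomogeneousCocycle α (homogeneousExtension α u) where
  homogeneous t a b ht ha hb := by
    unfold homogeneousExtension
    rw [← mul_add, Real.mul_rpow ht.le (by positivity), mul_div_mul_left _ _ ht.ne', mul_assoc]
  cocycle a b c ha hb hc := by
    have hT : 0 < a + b + c := by positivity
    have e := h (c / (a + b + c)) (a / (a + b + c)) (by positivity)
      (by rw [div_lt_one hT]; linarith) (by positivity) (by rw [div_lt_one hT]; linarith)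
      (by rw [← add_div, div_le_one hT]; linarith)
    have e1 : 1 - c / (a + b + c) = (a + b) / (a + b + c) := by field_simp; ring
    have e2 : 1 - a / (a + b + c) = (b + c) / (a + b + c) := by field_simp; ring
    have e3 : (a + b) / (a + b + c) - a / (a + b + c) = b / (a + b + c) := by field_simp; ring
    rw [e1, e2, e3, div_div_div_cancel_right₀ hT.ne', div_div_div_cancel_right₀ hT.ne',
      Real.div_rpow (by positivity) hT.le, Real.div_rpow (by positivity) hT.le] at e
    have hp : 0 < (a + b + c) ^ α := Real.rpow_pos_of_pos hT α
    unfold homogeneousExtension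
    rw [← add_assoc a b c]
    field_simp at e
    linarith

/-- An additive function on the positive reals that is bounded on `[1,2]` is linear. -/
theorem eq_mul_of_additive_of_bounded {f : ℝ → ℝ}
    (hadd : ∀ a b : ℝ, 0 < a → 0 < b → f (a + b) = f a + f b) {C : ℝ}
    (hC : ∀ x ∈ Icc (1 : ℝ) 2, |f x| ≤ C) {x : ℝ} (hx : 0 < x) : f x = x * f 1 := by
  have hnat : ∀ y : ℝ, 0 < y → ∀ n : ℕ, f ((n + 1 : ℕ) * y) = (n + 1 : ℕ) * f y := by
    intro y hy n
    induction n with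
    | zero => simp
    | succ n ih =>
      rw [Nat.cast_succ, add_mul, one_mul, hadd _ _ (by positivity) hy, ih]
      push_cast; ring
  -- Write `n * x = r + (k + 1)` with `r` in `[1, 2]`: then `n * (f x - x * f 1) = f r - r * f 1`,
  -- which is bounded independently of `n`.
  have hbound : ∀ n : ℕ, 2 ≤ n * x → n * |f x - x * f 1| ≤ C + 2 * |f 1| := by
    intro n hn
    obtain ⟨m, hm⟩ : ∃ m : ℕ, n ≠ 0 ∧ n = m + 1 := by
      rcases n with _ | n
      · norm_num at hn
      · exact ⟨n, by simp, rfl⟩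
    obtain ⟨-, rfl⟩ := hm
    -- One less than the floor is subtracted, so that both `r` and `k + 1` are positive, as
    -- additivity requires.
    obtain ⟨k, hk⟩ : ∃ k : ℕ, ⌊((m + 1 : ℕ) : ℝ) * x⌋₊ = k + 2 :=
      Nat.exists_eq_add_of_le' (Nat.le_floor (by exact_mod_cast hn))
    have h1 := Nat.floor_le (show 0 ≤ ((m + 1 : ℕ) : ℝ) * x by positivity)
    have h2 := Nat.lt_floor_add_one (((m + 1 : ℕ) : ℝ) * x)
    rw [hk] at h1 h2
    set r : ℝ := (m + 1 : ℕ) * x - (k + 1 : ℕ) with hr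
    have hr1 : 1 ≤ r := by push_cast at *; linarith
    have hr2 : r ≤ 2 := by push_cast at *; linarith
    have h3 : f ((m + 1 : ℕ) * x) = f r + (k + 1 : ℕ) * f 1 := by
      rw [← hnat 1 one_pos, ← hadd _ _ (by linarith) (by positivity)]
      congr 1
      rw [hr]; ring
    rw [hnat x hx] at h3
    have h4 : ((m + 1 : ℕ) : ℝ) * (f x - x * f 1) = f r - r * f 1 := by
      rw [mul_sub, h3, hr]; ring
    rw [← Nat.abs_cast (m + 1), ← abs_mul, h4]
    calc |f r - r * f 1| ≤ |f r| + |r * f 1| := abs_sub _ _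
      _ ≤ C + 2 * |f 1| := by
        rw [abs_mul, abs_of_pos (by linarith : 0 < r)]
        have := hC r ⟨hr1, hr2⟩
        gcongr
  by_contra hne
  have hpos : 0 < |f x - x * f 1| := abs_pos.2 (sub_ne_zero.2 hne)
  obtain ⟨n, hn⟩ := exists_nat_gt (max (2 / x) ((C + 2 * |f 1|) / |f x - x * f 1|))
  have h1 := (div_lt_iff₀ hx).1 ((le_max_left _ _).trans_lt hn)
  have h2 := (div_lt_iff₀ hpos).1 ((le_max_right _ _).trans_lt hn)
  linarith [hbound n h1.le]

namespace HomogeneousCocycle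

variable {α : ℝ} {F : ℝ → ℝ → ℝ}

/-- Add the cocycle identities at `(a, b, c)` and `(c, a, b)` and subtract the one at `(a, c, b)`.
-/
theorem antisymmetrization_add (hF : HomogeneousCocycle α F) {a b c : ℝ} (ha : 0 < a)
    (hb : 0 < b) (hc : 0 < c) :
    F (a + b) c - F c (a + b) = (F a c - F c a) + (F b c - F c b) := by
  have h1 := hF.cocycle a b c ha hb hc
  have h2 := hF.cocycle c a b hc ha hb
  have h3 := hF.cocycle a c b ha hc hb
  rw [add_comm c b, add_comm a c] at h3
  linarith

theorem antisymmetrization_natCast_mul (hF : HomogeneousCocycle α F) {a c : ℝ} (ha : 0 < a)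
    (hc : 0 < c) (n : ℕ) :
    F ((n + 1 : ℕ) * a) c - F c ((n + 1 : ℕ) * a) = (n + 1 : ℕ) * (F a c - F c a) := by
  induction n with
  | zero => simp
  | succ n ih =>
    rw [Nat.cast_succ, add_mul, one_mul, hF.antisymmetrization_add (by positivity) ha hc, ih]
    push_cast; ring

theorem natCast_symm (hF : HomogeneousCocycle α F) (m n : ℕ) :
    F (m + 1 : ℕ) (n + 1 : ℕ) = F (n + 1 : ℕ) (m + 1 : ℕ) := by
  have h1 := hF.antisymmetrization_natCast_mul one_pos (c := (n + 1 : ℕ)) (by positivity) m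
  have h2 := hF.antisymmetrization_natCast_mul one_pos one_pos n
  rw [mul_one] at h1 h2
  rw [sub_self, mul_zero] at h2
  rw [← sub_eq_zero, h1, show F 1 (n + 1 : ℕ) - F (n + 1 : ℕ) 1 = 0 by linarith, mul_zero]

/-- Three cocycle identities show that `F (2a) (2b) - 2 F a b` is the coboundary of `t ↦ F t t`;
homogeneity evaluates `F (2a) (2b)` and `F t t`. Both sides vanish when `α = 1`. -/
theorem double (hF : HomogeneousCocycle α F)
    (hs : ∀ a b : ℝ, 0 < a → 0 < b → F a b = F b a) {a b : ℝ} (ha : 0 < a) (hb : 0 < b) :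
    (2 ^ α - 2) * F a b = F 1 1 * ((a + b) ^ α - a ^ α - b ^ α) := by
  have hdiag : ∀ t : ℝ, 0 < t → F t t = t ^ α * F 1 1 := fun t ht => by
    simpa using hF.homogeneous t 1 1 ht one_pos one_pos
  have h1 := hF.cocycle a a (2 * b) ha ha (by positivity)
  have h2 := hF.cocycle a b (a + b) ha hb (by positivity)
  have h3 := hF.cocycle b b a hb hb ha
  have h4 := hF.homogeneous 2 a b two_pos ha hb
  rw [show a + a = 2 * a by ring, h4] at h1
  rw [show b + (a + b) = a + 2 * b by ring] at h2
  rw [show b + b = 2 * b by ring, hs (2 * b) a (by positivity) ha, hs b a hb ha,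
    add_comm b a] at h3
  linear_combination h1 - h2 + h3 + hdiag (a + b) (by positivity) - hdiag a ha - hdiag b hb

end HomogeneousCocycle

theorem FundamentalEquation.symm_ratCast {α : ℝ} (hα : 0 < α) {u : ℝ → ℝ}
    (h : FundamentalEquation α u) (q : ℚ) (hq : (q : ℝ) ∈ Icc (0 : ℝ) 1) :
    u q = u (1 - q) := by
  rcases hq.1.eq_or_lt with h0 | h0
  · rw [← h0, sub_zero, h.map_zero hα, h.map_one hα]
  rcases hq.2.eq_or_lt with h1 | h1
  · rw [h1, sub_self, h.map_zero hα, h.map_one hα]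
  have hd : (0 : ℝ) < q.den := by exact_mod_cast q.pos
  have hqd : (q : ℝ) = q.num / q.den := Rat.cast_def q
  have hn0 : 0 < q.num := Rat.num_pos.2 (by exact_mod_cast h0)
  have hn1 : q.num < q.den := by
    rw [hqd, div_lt_one hd] at h1
    exact_mod_cast h1
  obtain ⟨m, hm⟩ : ∃ m : ℕ, q.num = (m + 1 : ℕ) := ⟨(q.num - 1).toNat, by omega⟩
  obtain ⟨n, hn⟩ : ∃ n : ℕ, (q.den : ℤ) - q.num = (n + 1 : ℕ) :=
    ⟨((q.den : ℤ) - q.num - 1).toNat, by omega⟩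
  have hm' : (q.num : ℝ) = (m + 1 : ℕ) := by exact_mod_cast hm
  have hn' : (q.den : ℝ) - q.num = (n + 1 : ℕ) := by exact_mod_cast hn
  have e1 : (q : ℝ) = (q.den : ℝ)⁻¹ * (m + 1 : ℕ) := by rw [← hm', hqd]; ring
  have e2 : 1 - (q : ℝ) = (q.den : ℝ)⁻¹ * (n + 1 : ℕ) := by rw [← hn', hqd]; field_simp
  have hF := h.homogeneousCocycle
  have e3 := homogeneousExtension_one_sub α u (1 - q)
  rw [sub_sub_cancel] at e3
  rw [← homogeneousExtension_one_sub α u q, ← e3, e2, e1,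
    hF.homogeneous _ _ _ (by positivity) (by positivity) (by positivity),
    hF.homogeneous _ _ _ (by positivity) (by positivity) (by positivity), hF.natCast_symm]

/-! ### Measurability, local boundedness and symmetry -/

/-- Lebesgue measurability survives composition only if preimages of null sets are null. Here a
preimage is the image of a null set under the differentiable inverse `t ↦ 1 / t - 1`. -/
theorem quasiMeasurePreserving_one_div_one_add :
    Measure.QuasiMeasurePreserving (fun s : ℝ => 1 / (1 + s))
      (volume.restrict (Ioi 0)) (volume.restrict (Icc 0 1)) := by
  have hm : Measurable (fun s : ℝ => 1 / (1 + s)) := by fun_prop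
  refine ⟨hm, Measure.AbsolutelyContinuous.mk fun N hN h0 => ?_⟩
  rw [Measure.restrict_apply hN] at h0
  rw [Measure.map_apply hm hN, Measure.restrict_apply (hm hN)]
  have hd : DifferentiableOn ℝ (fun t : ℝ => 1 / t - 1) (N ∩ Ioc 0 1) := fun t ht =>
    (((differentiableAt_const _).div differentiableAt_id ht.2.1.ne').sub_const
      1).differentiableWithinAt
  refine measure_mono_null ?_ (addHaar_image_eq_zero_of_differentiableOn_of_addHaar_eq_zero
    volume hd (measure_mono_null (inter_subset_inter_right N Ioc_subset_Icc_self) h0))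
  rintro s ⟨hs, hs0 : 0 < s⟩
  refine ⟨1 / (1 + s), ⟨hs, by positivity, ?_⟩, ?_⟩
  · rw [div_le_one (by positivity)]; linarith
  · field_simp; ring

theorem aemeasurable_homogeneousExtension {α : ℝ} {u : ℝ → ℝ}
    (hu : AEMeasurable u (volume.restrict (Icc (0 : ℝ) 1))) :
    AEMeasurable (homogeneousExtension α u 1) (volume.restrict (Ioi 0)) := by
  have h1 : Measurable (fun s : ℝ => (1 + s) ^ α) := by fun_prop
  exact h1.aemeasurable.mul
    (hu.comp_quasiMeasurePreserving quasiMeasurePreserving_one_div_one_add)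

/-- A measurable function on a set of finite measure is bounded off a set of small measure. -/
theorem exists_measure_lt_abs_le {X : Type*} [MeasurableSpace X] {ν : Measure X}
    [IsFiniteMeasure ν] {w : X → ℝ} (hw : AEMeasurable w ν) {ε : ENNReal} (hε : 0 < ε) :
    ∃ n : ℕ, ν {t | (n : ℝ) < |w t|} < ε := by
  have ht := tendsto_measure_iInter_atTop (μ := ν) (s := fun n : ℕ => {t | (n : ℝ) < |w t|})
    (fun n => nullMeasurableSet_lt aemeasurable_const hw.abs)
    (fun m n hmn t (ht : (n : ℝ) < |w t|) =>
      show (m : ℝ) < |w t| from (Nat.cast_le.2 hmn).trans_lt ht)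
    ⟨0, measure_ne_top _ _⟩
  have he : ⋂ n : ℕ, {t | (n : ℝ) < |w t|} = ∅ := by
    refine eq_empty_of_forall_notMem fun t ht => ?_
    obtain ⟨n, hn⟩ := exists_nat_gt |w t|
    exact lt_asymm hn (mem_iInter.1 ht n)
  rw [he, measure_empty] at ht
  exact (ht.eventually_lt_const hε).exists

namespace HomogeneousCocycle

variable {α : ℝ} {F : ℝ → ℝ → ℝ}

theorem eq_rpow_mul (hF : HomogeneousCocycle α F) {a b : ℝ} (ha : 0 < a) (hb : 0 < b) :
    F a b = a ^ α * F 1 (b / a) := by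
  have := hF.homogeneous a 1 (b / a) ha one_pos (by positivity)
  rwa [mul_one, mul_div_cancel₀ _ ha.ne'] at this

/-- The cocycle identity at `(1, s, c)` expresses `F 1 s` through `F 1` at `c / s`, `s + c` and `c /
(1 + s)`. Since `c` is free, it can be chosen so that all three points avoid a small set off which
`F 1` is bounded. -/
theorem bounded_on_Icc (hF : HomogeneousCocycle α F) (hα : 0 ≤ α)
    (hw : AEMeasurable (F 1) (volume.restrict (Ioi 0))) {m M : ℝ} (hm : 0 < m) :
    ∃ C : ℝ, ∀ s ∈ Icc m M, |F 1 s| ≤ C := by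
  rcases lt_or_ge M m with hMm | hMm
  · exact ⟨0, fun s hs => absurd (hs.1.trans hs.2) (not_le.2 hMm)⟩
  have hM : 0 < M := hm.trans_le hMm
  -- `J` contains the three points for all `s` in `[m, M]` and `c` in `[1, 2]`.
  set J : Set ℝ := Icc (1 / (1 + M)) (2 / m + M + 2) with hJ
  have hJ0 : J ⊆ Ioi 0 := fun t ht => lt_of_lt_of_le (by positivity) ht.1
  obtain ⟨n, hn⟩ := exists_measure_lt_abs_le (hw.mono_measure (Measure.restrict_mono_set _ hJ0))
    (ε := ENNReal.ofReal (1 / (2 * M + 3))) (ENNReal.ofReal_pos.2 (by positivity))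
  rw [Measure.restrict_apply' measurableSet_Icc] at hn
  set B : Set ℝ := {t | (n : ℝ) < |F 1 t|} ∩ J with hB
  have hgood : ∀ t ∈ J, t ∉ B → |F 1 t| ≤ n := fun t ht htB =>
    not_lt.1 fun h => htB ⟨h, ht⟩
  refine ⟨M ^ α * n + n + (1 + M) ^ α * n, fun s hs => ?_⟩
  have hs0 : 0 < s := hm.trans_le hs.1
  -- The bad `c` have measure at most `(s + 1 + (1 + s)) * |B| ≤ (2M + 2) / (2M + 3) < 1`, so they
  -- cannot fill `[1, 2]`.
  obtain ⟨c, hc, hc1, hc2, hc3⟩ : ∃ c ∈ Icc (1 : ℝ) 2,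
      s⁻¹ * c ∉ B ∧ s + c ∉ B ∧ (1 + s)⁻¹ * c ∉ B := by
    by_contra! hcon
    have hsub : Icc (1 : ℝ) 2 ⊆ ((s⁻¹ * ·) ⁻¹' B ∪ (s + ·) ⁻¹' B) ∪ ((1 + s)⁻¹ * ·) ⁻¹' B := by
      intro c hc
      by_cases h1 : s⁻¹ * c ∈ B
      · exact Or.inl (Or.inl h1)
      by_cases h2 : s + c ∈ B
      · exact Or.inl (Or.inr h2)
      · exact Or.inr (hcon c hc h1 h2)
    have hle : volume (Icc (1 : ℝ) 2) ≤ ENNReal.ofReal s * volume B + volume B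
        + ENNReal.ofReal (1 + s) * volume B := by
      refine (measure_mono hsub).trans ((measure_union_le _ _).trans
        (add_le_add ((measure_union_le _ _).trans (add_le_add ?_ ?_)) ?_))
      · rw [Real.volume_preimage_mul_left (by positivity), inv_inv, abs_of_pos hs0]
      · rw [measure_preimage_add]
      · rw [Real.volume_preimage_mul_left (by positivity), inv_inv, abs_of_pos (by positivity)]
    have hlt : ENNReal.ofReal s * volume B + volume B + ENNReal.ofReal (1 + s) * volume B
        ≤ ENNReal.ofReal ((2 * M + 2) / (2 * M + 3)) := by
      calc _ = ENNReal.ofReal (s + 1 + (1 + s)) * volume B := by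
            rw [ENNReal.ofReal_add (p := s + 1) (by positivity) (by positivity),
              ENNReal.ofReal_add (p := s) (by positivity) (by positivity), ENNReal.ofReal_one]
            ring
        _ ≤ ENNReal.ofReal (2 * M + 2) * ENNReal.ofReal (1 / (2 * M + 3)) := by
            exact mul_le_mul' (ENNReal.ofReal_le_ofReal (by linarith [hs.2])) hn.le
        _ = _ := by
            rw [← ENNReal.ofReal_mul (by positivity)]
            congr 1; ring
    have h := hle.trans hlt
    rw [Real.volume_Icc, ENNReal.ofReal_le_ofReal_iff (by positivity),
      le_div_iff₀ (by positivity)] at h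
    linarith
  have hc0 : 0 < c := one_pos.trans_le hc.1
  have h1M : 1 / (1 + M) ≤ 1 := by rw [div_le_one (by positivity)]; linarith
  have j1 : s⁻¹ * c ∈ J := by
    rw [inv_mul_eq_div]
    constructor
    · exact div_le_div₀ hc0.le hc.1 hs0 (by linarith [hs.2])
    · have := div_le_div₀ zero_le_two hc.2 hm hs.1
      linarith
  have j2 : s + c ∈ J := by
    have : 0 < 2 / m := by positivity
    exact ⟨by linarith [hc.1], by linarith [hs.2, hc.2]⟩
  have j3 : (1 + s)⁻¹ * c ∈ J := by
    rw [inv_mul_eq_div]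
    constructor
    · exact div_le_div₀ hc0.le hc.1 (by positivity) (by linarith [hs.2])
    · have := div_le_div₀ zero_le_two hc.2 hm (by linarith [hs.1] : m ≤ 1 + s)
      linarith
  have e := hF.cocycle 1 s c one_pos hs0 hc0
  rw [hF.eq_rpow_mul hs0 hc0, hF.eq_rpow_mul (by positivity : 0 < 1 + s) hc0,
    ← inv_mul_eq_div, ← inv_mul_eq_div] at e
  have b1 := hgood _ j1 hc1
  have b2 := hgood _ j2 hc2
  have b3 := hgood _ j3 hc3
  have p1 : s ^ α ≤ M ^ α := Real.rpow_le_rpow hs0.le hs.2 hα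
  have p3 : (1 + s) ^ α ≤ (1 + M) ^ α :=
    Real.rpow_le_rpow (by positivity) (by linarith [hs.2]) hα
  have q1 : |s ^ α * F 1 (s⁻¹ * c)| ≤ M ^ α * n := by
    rw [abs_mul, abs_of_pos (by positivity)]; gcongr
  have q3 : |(1 + s) ^ α * F 1 ((1 + s)⁻¹ * c)| ≤ (1 + M) ^ α * n := by
    rw [abs_mul, abs_of_pos (by positivity)]; gcongr
  rw [abs_le] at *
  constructor <;> linarith

theorem symm_of_aemeasurable (hF : HomogeneousCocycle α F) (hα : 0 ≤ α)
    (hw : AEMeasurable (F 1) (volume.restrict (Ioi 0))) {a b : ℝ} (ha : 0 < a) (hb : 0 < b) :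
    F a b = F b a := by
  -- Since `F s 1 = s ^ α * F 1 (1 / s)`, the range must contain `s` and `1 / s` for `s` in `[1,
  -- 2]`.
  obtain ⟨C, hC⟩ := hF.bounded_on_Icc hα hw (m := 1 / 2) (M := 2) (by norm_num)
  have hbd : ∀ s ∈ Icc (1 : ℝ) 2, |F s 1 - F 1 s| ≤ 2 ^ α * C + C := by
    intro s hs
    have hs0 : 0 < s := one_pos.trans_le hs.1
    have c1 := hC s ⟨by linarith [hs.1], hs.2⟩
    have c2 := hC (1 / s) ⟨one_div_le_one_div_of_le hs0 hs.2, by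
      rw [div_le_iff₀ hs0]; linarith [hs.1]⟩
    have p1 : s ^ α ≤ 2 ^ α := Real.rpow_le_rpow hs0.le hs.2 hα
    refine (abs_sub _ _).trans (add_le_add ?_ c1)
    rw [hF.eq_rpow_mul hs0 one_pos, abs_mul, abs_of_pos (by positivity)]
    gcongr
  have hz : ∀ s : ℝ, 0 < s → F s 1 = F 1 s := fun s hs => by
    have := eq_mul_of_additive_of_bounded (f := fun s => F s 1 - F 1 s)
      (fun a b ha hb => hF.antisymmetrization_add ha hb one_pos) hbd hs
    rw [sub_self, mul_zero] at this
    linarith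
  have h1 := hF.homogeneous b (a / b) 1 hb (by positivity) one_pos
  have h2 := hF.homogeneous b 1 (a / b) hb one_pos (by positivity)
  rw [mul_div_cancel₀ _ hb.ne', mul_one] at h1 h2
  rw [h1, h2, hz _ (by positivity)]

theorem eq_rpow_of_ne_one (hF : HomogeneousCocycle α F) (hα : α ≠ 1)
    (hs : ∀ a b : ℝ, 0 < a → 0 < b → F a b = F b a) {a b : ℝ} (ha : 0 < a) (hb : 0 < b) :
    F a b = F 1 1 / (2 ^ α - 2) * ((a + b) ^ α - a ^ α - b ^ α) := by
  have h2 : (2 : ℝ) ^ α - 2 ≠ 0 := by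
    refine sub_ne_zero.2 fun h => hα ?_
    exact (Real.rpow_right_inj two_pos (by norm_num)).1 (h.trans (Real.rpow_one 2).symm)
  rw [div_mul_eq_mul_div, eq_div_iff h2, ← hF.double hs ha hb]
  ring

end HomogeneousCocycle

/-! ### The case `α = 1`: primitives and logarithms -/

/-- A function on the positive reals with `l (t * a) = l t + l a`, bounded on compact
subintervals, is a multiple of the logarithm. -/
theorem eq_mul_log_of_mul_add_of_bounded {l : ℝ → ℝ}
    (hmul : ∀ t a : ℝ, 0 < t → 0 < a → l (t * a) = l t + l a)
    (hbd : ∀ m M : ℝ, 0 < m → ∃ C : ℝ, ∀ x ∈ Icc m M, |l x| ≤ C) {a : ℝ} (ha : 0 < a) :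
    l a = l (Real.exp 1) * Real.log a := by
  obtain ⟨C, hC⟩ := hbd (Real.exp 1) (Real.exp 2) (Real.exp_pos 1)
  have hlin : ∀ x : ℝ, 0 < x → l (Real.exp x) = x * l (Real.exp 1) := fun x hx =>
    eq_mul_of_additive_of_bounded (f := fun x => l (Real.exp x))
      (fun x y _ _ => by
        show l (Real.exp (x + y)) = _
        rw [Real.exp_add, hmul _ _ (Real.exp_pos x) (Real.exp_pos y)])
      (fun x hx => hC _ ⟨Real.exp_le_exp.2 hx.1, Real.exp_le_exp.2 hx.2⟩) hx
  have hone : l 1 = 0 := by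
    have := hmul 1 1 one_pos one_pos
    rw [mul_one] at this
    linarith
  rcases lt_trichotomy (Real.log a) 0 with h | h | h
  · have h1 := hlin (-Real.log a) (by linarith)
    have h2 := hmul a a⁻¹ ha (inv_pos.2 ha)
    rw [Real.exp_neg, Real.exp_log ha] at h1
    rw [mul_inv_cancel₀ ha.ne', hone, h1] at h2
    linarith
  · rw [Real.eq_one_of_pos_of_log_eq_zero ha h, hone, Real.log_one, mul_zero]
  · have h1 := hlin _ h
    rw [Real.exp_log ha] at h1
    rw [h1, mul_comm]

namespace HomogeneousCocycle

variable {F : ℝ → ℝ → ℝ}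

theorem intervalIntegrable (hF : HomogeneousCocycle 1 F)
    (hw : AEMeasurable (F 1) (volume.restrict (Ioi 0))) {a p q : ℝ} (ha : 0 < a) (hp : 0 < p)
    (hpq : p ≤ q) : IntervalIntegrable (F a) volume p q := by
  have h1 : ∀ p q : ℝ, 0 < p → p ≤ q → IntervalIntegrable (F 1) volume p q := by
    intro p q hp hpq
    obtain ⟨C, hC⟩ := hF.bounded_on_Icc zero_le_one hw (M := q) hp
    rw [intervalIntegrable_iff_integrableOn_Icc_of_le hpq]
    have hsub : Icc p q ⊆ Ioi 0 := fun t ht => hp.trans_le ht.1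
    refine Integrable.of_bound
      (hw.mono_measure (Measure.restrict_mono_set _ hsub)).aestronglyMeasurable C ?_
    exact (ae_restrict_iff' measurableSet_Icc).2 (Filter.Eventually.of_forall hC)
  have h2 := ((h1 (a⁻¹ * p) (a⁻¹ * q) (by positivity) (by gcongr)).comp_mul_left
    (c := a⁻¹)).const_mul a
  rw [mul_div_cancel_left₀ _ (inv_ne_zero ha.ne'),
    mul_div_cancel_left₀ _ (inv_ne_zero ha.ne')] at h2
  refine h2.congr fun x hx => ?_
  rw [uIoc_of_le hpq] at hx
  have hx0 : 0 < x := hp.trans hx.1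
  show a * F 1 (a⁻¹ * x) = F a x
  rw [hF.eq_rpow_mul ha hx0, Real.rpow_one, inv_mul_eq_div]

/-- A primitive of a cocycle. -/
noncomputable def primitive (F : ℝ → ℝ → ℝ) (a : ℝ) : ℝ :=
  (∫ c in (1 : ℝ)..2, F a c) - ∫ c in (1 : ℝ)..(1 + a), F 1 c

/-- Integrating the identity at `(a, b, c)` over `c` in `[1, 2]` leaves the integral of `F a` over
`[b + 1, b + 2]`. It differs from that over `[1, 2]` by the integral of `F a (1 + c) - F a c` over
`[1, b + 1]`; by the identity at `(a, c, 1)` and symmetry, that integrand is `F 1 (a + c) - F 1 c`,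
whose integral is a coboundary. -/
theorem eq_primitive (hF : HomogeneousCocycle 1 F)
    (hw : AEMeasurable (F 1) (volume.restrict (Ioi 0)))
    (hs : ∀ a b : ℝ, 0 < a → 0 < b → F a b = F b a) {a b : ℝ} (ha : 0 < a) (hb : 0 < b) :
    F a b = primitive F a + primitive F b - primitive F (a + b) := by
  have hI : ∀ a p q : ℝ, 0 < a → 0 < p → p ≤ q → IntervalIntegrable (F a) volume p q :=
    fun a p q => hF.intervalIntegrable hw
  have hab : 0 < a + b := add_pos ha hb
  have e1 : ∫ c in (1 : ℝ)..2, F a (b + c) =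
      (∫ c in (1 : ℝ)..2, F b c) * (-1) + (∫ c in (1 : ℝ)..2, F (a + b) c) + F a b := by
    have : ∀ c ∈ uIcc (1 : ℝ) 2, F a (b + c) = F b c * (-1) + F (a + b) c + F a b := by
      intro c hc
      rw [uIcc_of_le one_le_two] at hc
      have := hF.cocycle a b c ha hb (one_pos.trans_le hc.1)
      linarith
    rw [intervalIntegral.integral_congr this, intervalIntegral.integral_add
      (((hI b 1 2 hb one_pos one_le_two).mul_const _).add (hI _ 1 2 hab one_pos one_le_two))
      intervalIntegrable_const, intervalIntegral.integral_add
      ((hI b 1 2 hb one_pos one_le_two).mul_const _) (hI _ 1 2 hab one_pos one_le_two),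
      intervalIntegral.integral_mul_const, intervalIntegral.integral_const]
    norm_num
  have e2 : ∫ c in (1 : ℝ)..2, F a (b + c) = ∫ c in (b + 1)..(b + 2), F a c :=
    intervalIntegral.integral_comp_add_left (F a) b
  have e3 : (∫ c in (1 : ℝ)..(b + 1), F a (1 + c)) = ∫ c in (2 : ℝ)..(b + 2), F a c := by
    rw [intervalIntegral.integral_comp_add_left (F a) 1]
    congr 1 <;> ring
  have e4 : (∫ c in (1 : ℝ)..(b + 1), F a (1 + c)) = (∫ c in (1 : ℝ)..(b + 1), F a c) +
      (∫ c in (1 : ℝ)..(b + 1), F 1 (a + c)) - ∫ c in (1 : ℝ)..(b + 1), F 1 c := by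
    have h1b : (1 : ℝ) ≤ b + 1 := by linarith
    have hsh : IntervalIntegrable (fun c => F 1 (a + c)) volume 1 (b + 1) := by
      have := (hI 1 (1 + a) (b + 1 + a) one_pos (by positivity) (by linarith)).comp_add_left a
      simpa using this
    rw [← intervalIntegral.integral_add (hI a _ _ ha one_pos h1b) hsh,
      ← intervalIntegral.integral_sub ((hI a _ _ ha one_pos h1b).add hsh)
        (hI 1 _ _ one_pos one_pos h1b)]
    refine intervalIntegral.integral_congr fun c hc => ?_
    rw [uIcc_of_le h1b] at hc
    have hc0 : 0 < c := one_pos.trans_le hc.1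
    have := hF.cocycle a c 1 ha hc0 one_pos
    rw [hs (a + c) 1 (by positivity) one_pos, hs c 1 hc0 one_pos, add_comm c 1] at this
    show F a (1 + c) = F a c + F 1 (a + c) - F 1 c
    linarith
  have e5 : (∫ c in (1 : ℝ)..(b + 1), F 1 (a + c)) = ∫ c in (1 + a)..(1 + (a + b)), F 1 c := by
    rw [intervalIntegral.integral_comp_add_left (F 1) a]
    congr 1 <;> ring
  have e6 := intervalIntegral.integral_add_adjacent_intervals
    (hI 1 1 (1 + a) one_pos one_pos (by linarith))
    (hI 1 (1 + a) (1 + (a + b)) one_pos (by positivity) (by linarith))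
  have e7 := intervalIntegral.integral_add_adjacent_intervals
    (hI a 1 (b + 1) ha one_pos (by linarith))
    (hI a (b + 1) (b + 2) ha (by positivity) (by linarith))
  have e8 := intervalIntegral.integral_add_adjacent_intervals
    (hI a 1 2 ha one_pos one_le_two) (hI a 2 (b + 2) ha two_pos (by linarith))
  unfold primitive
  rw [add_comm 1 b]
  linarith

theorem primitive_bounded (hF : HomogeneousCocycle 1 F)
    (hw : AEMeasurable (F 1) (volume.restrict (Ioi 0))) {m M : ℝ} (hm : 0 < m) :
    ∃ C : ℝ, ∀ a ∈ Icc m M, |primitive F a| ≤ C := by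
  obtain ⟨C₁, h₁⟩ := hF.bounded_on_Icc zero_le_one hw (m := 1 / max m M) (M := 2 / m)
    (by positivity)
  obtain ⟨C₂, h₂⟩ := hF.bounded_on_Icc zero_le_one hw (m := 1) (M := 1 + M) one_pos
  refine ⟨M * C₁ + C₂ * M, fun a ha => ?_⟩
  have ha0 : 0 < a := hm.trans_le ha.1
  have b1 : ‖∫ c in (1 : ℝ)..2, F a c‖ ≤ M * C₁ * |2 - 1| := by
    refine intervalIntegral.norm_integral_le_of_norm_le_const fun c hc => ?_
    rw [uIoc_of_le one_le_two] at hc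
    have hc0 : 0 < c := one_pos.trans hc.1
    have hb := h₁ (c / a) ⟨div_le_div₀ hc0.le hc.1.le ha0 (ha.2.trans (le_max_right _ _)),
      div_le_div₀ zero_le_two hc.2 hm ha.1⟩
    rw [hF.eq_rpow_mul ha0 hc0, Real.rpow_one, norm_mul, Real.norm_of_nonneg ha0.le]
    exact mul_le_mul ha.2 hb (norm_nonneg _) (ha0.le.trans ha.2)
  have b2 : ‖∫ c in (1 : ℝ)..(1 + a), F 1 c‖ ≤ C₂ * |1 + a - 1| := by
    refine intervalIntegral.norm_integral_le_of_norm_le_const fun c hc => ?_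
    rw [uIoc_of_le (by linarith)] at hc
    exact h₂ c ⟨hc.1.le, by linarith [hc.2, ha.2]⟩
  have hC₂ : 0 ≤ C₂ := (abs_nonneg _).trans (h₂ 1 ⟨le_rfl, by linarith [ha.2]⟩)
  have b3 : C₂ * |1 + a - 1| ≤ C₂ * M := by
    rw [add_sub_cancel_left, abs_of_pos ha0]
    exact mul_le_mul_of_nonneg_left ha.2 hC₂
  refine (abs_sub _ _).trans (add_le_add ?_ (b2.trans b3))
  norm_num at b1
  exact b1

theorem eq_log_of_symm (hF : HomogeneousCocycle 1 F)
    (hw : AEMeasurable (F 1) (volume.restrict (Ioi 0)))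
    (hs : ∀ a b : ℝ, 0 < a → 0 < b → F a b = F b a) :
    ∃ κ : ℝ, ∀ a b : ℝ, 0 < a → 0 < b → F a b =
      κ * (a * Real.log a + b * Real.log b - (a + b) * Real.log (a + b)) := by
  set K := primitive F with hK
  have hKF : ∀ a b : ℝ, 0 < a → 0 < b → F a b = K a + K b - K (a + b) :=
    fun a b => hF.eq_primitive hw hs
  -- Homogeneity says that `K (t * a) - t * K a`, as a function of `a`, has zero coboundary, so it
  -- is additive; being bounded on `[1, 2]`, it is linear.
  have hscale : ∀ t a : ℝ, 0 < t → 0 < a → K (t * a) - t * K a = a * (K t - t * K 1) := by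
    intro t a ht ha
    obtain ⟨C₁, h₁⟩ := hF.primitive_bounded hw (m := t) (M := t * 2) ht
    obtain ⟨C₂, h₂⟩ := hF.primitive_bounded hw (m := 1) (M := 2) one_pos
    have := eq_mul_of_additive_of_bounded (f := fun a => K (t * a) - t * K a)
      (C := C₁ + t * C₂) (fun a b ha hb => ?_) (fun x hx => ?_) ha
    · simpa using this
    · have e1 := hF.homogeneous t a b ht ha hb
      rw [hKF a b ha hb, hKF _ _ (mul_pos ht ha) (mul_pos ht hb), Real.rpow_one,
        ← mul_add] at e1
      show K (t * (a + b)) - t * K (a + b) = _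
      linarith
    · refine (abs_sub _ _).trans (add_le_add (h₁ _ ⟨?_, ?_⟩) ?_)
      · exact le_mul_of_one_le_right ht.le hx.1
      · exact mul_le_mul_of_nonneg_left hx.2 ht.le
      · rw [abs_mul, abs_of_pos ht]
        exact mul_le_mul_of_nonneg_left (h₂ x hx) ht.le
  -- Dividing `hscale` by `t * a` makes `K a / a - K 1` turn products into sums. The remaining term
  -- `a * K 1` of `K a` is additive and drops out of `F`.
  have hlog : ∀ a : ℝ, 0 < a → K a / a - K 1 =
      (K (Real.exp 1) / Real.exp 1 - K 1) * Real.log a := by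
    intro a ha
    refine eq_mul_log_of_mul_add_of_bounded (l := fun a => K a / a - K 1)
      (fun t a ht ha => ?_) (fun m M hm => ?_) ha
    · have := hscale t a ht ha
      field_simp
      linarith
    · obtain ⟨C, hC⟩ := hF.primitive_bounded hw (M := M) hm
      refine ⟨C / m + |K 1|, fun x hx => (abs_sub _ _).trans (add_le_add ?_ le_rfl)⟩
      have hx0 : 0 < x := hm.trans_le hx.1
      rw [abs_div, abs_of_pos hx0]
      exact div_le_div₀ ((abs_nonneg _).trans (hC x hx)) (hC x hx) hm hx.1
  refine ⟨K (Real.exp 1) / Real.exp 1 - K 1, fun a b ha hb => ?_⟩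
  have hKa : ∀ a : ℝ, 0 < a → K a =
      a * ((K (Real.exp 1) / Real.exp 1 - K 1) * Real.log a) + a * K 1 := fun a ha => by
    rw [← hlog a ha]; field_simp; ring
  rw [hKF a b ha hb, hKa a ha, hKa b hb, hKa (a + b) (by positivity)]
  ring

end HomogeneousCocycle

/-! ### The entropies as solutions, and the classification -/

theorem binaryEntropy_zero {α : ℝ} (hα : 0 < α) : binaryEntropy α 0 = 0 := by
  unfold binaryEntropy
  split_ifs <;> simp [Real.zero_rpow hα.ne']

theorem binaryEntropy_one {α : ℝ} (hα : 0 < α) : binaryEntropy α 1 = 0 := by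
  unfold binaryEntropy
  split_ifs <;> simp [Real.zero_rpow hα.ne']

theorem measurable_binaryEntropy (α : ℝ) : Measurable (binaryEntropy α) := by
  unfold binaryEntropy
  split_ifs <;> fun_prop

theorem contDiffOn_binaryEntropy (α : ℝ) : ContDiffOn ℝ ∞ (binaryEntropy α) (Ioo 0 1) := by
  have h0 : ∀ x ∈ Ioo (0 : ℝ) 1, x ≠ 0 := fun x hx => hx.1.ne'
  have h1 : ∀ x ∈ Ioo (0 : ℝ) 1, 1 - x ≠ 0 := fun x hx => (sub_pos.2 hx.2).ne'
  have hsub : ContDiffOn ℝ ∞ (fun x : ℝ => 1 - x) (Ioo 0 1) := contDiffOn_const.sub contDiffOn_id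
  unfold binaryEntropy
  split_ifs
  · exact (contDiffOn_id.neg.mul (contDiffOn_id.log h0)).sub (hsub.mul (hsub.log h1))
  · exact contDiffOn_const.mul (((contDiffOn_id.rpow_const_of_ne h0).add
      (hsub.rpow_const_of_ne h1)).sub contDiffOn_const)

theorem fundamentalEquation_binaryEntropy {α : ℝ} (hα : 0 < α) :
    FundamentalEquation α (binaryEntropy α) := by
  intro x y hx0 hx1 hy0 hy1 hxy
  have hx : 0 < 1 - x := by linarith
  have hy : 0 < 1 - y := by linarith
  have hz : 0 ≤ 1 - x - y := by linarith
  have e1 : 1 - y / (1 - x) = (1 - x - y) / (1 - x) := by field_simp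
  have e2 : 1 - (1 - x - y) / (1 - y) = x / (1 - y) := by field_simp; ring
  unfold binaryEntropy
  rw [e1, e2, sub_sub_cancel]
  split_ifs with h
  · subst h
    have hlog : ∀ p q : ℝ, 0 ≤ p → 0 < q →
        p / q * Real.log (p / q) = (p * Real.log p - p * Real.log q) / q := by
      intro p q hp hq
      -- At `p = 0` the logarithm of the quotient does not split, but the factor `p` kills every
      -- term.
      rcases hp.eq_or_lt with rfl | hp
      · simp
      · rw [Real.log_div hp.ne' hq.ne']; ring
    rw [neg_mul, neg_mul, hlog _ _ hy0 hx, hlog _ _ hz hx, neg_mul, neg_mul, hlog _ _ hz hy,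
      hlog _ _ hx0 hy, Real.rpow_one, Real.rpow_one]
    field_simp
    ring
  · rw [Real.div_rpow hy0 hx.le, Real.div_rpow hz hx.le, Real.div_rpow hz hy.le,
      Real.div_rpow hx0 hy.le]
    have p1 := (Real.rpow_pos_of_pos hx α).ne'
    have p2 := (Real.rpow_pos_of_pos hy α).ne'
    have p3 : 1 - α ≠ 0 := fun h' => h (by linarith)
    field_simp
    ring

theorem FundamentalEquation.const_mul_of_eqOn {α c : ℝ} {u v : ℝ → ℝ}
    (hv : FundamentalEquation α v) (h : ∀ x ∈ Icc (0 : ℝ) 1, u x = c * v x) :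
    FundamentalEquation α u := by
  intro x y hx0 hx1 hy0 hy1 hxy
  have hx : 0 < 1 - x := by linarith
  have hy : 0 < 1 - y := by linarith
  rw [h _ ⟨hx.le, by linarith⟩, h _ ⟨hy0, hy1.le⟩,
    h (y / (1 - x)) ⟨by positivity, by rw [div_le_one hx]; linarith⟩,
    h ((1 - x - y) / (1 - y)) ⟨div_nonneg (by linarith) hy.le, by rw [div_le_one hy]; linarith⟩]
  linear_combination c * hv x y hx0 hx1 hy0 hy1 hxy

theorem FundamentalEquation.eq_mul_binaryEntropy {α : ℝ} (hα : 0 < α) {u : ℝ → ℝ}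
    (h : FundamentalEquation α u) (hu : AEMeasurable u (volume.restrict (Icc (0 : ℝ) 1))) :
    ∃ c : ℝ, ∀ x ∈ Icc (0 : ℝ) 1, u x = c * binaryEntropy α x := by
  have hF := h.homogeneousCocycle
  have hw := aemeasurable_homogeneousExtension (α := α) hu
  have hs := fun a b ha hb => hF.symm_of_aemeasurable hα.le hw (a := a) (b := b) ha hb
  suffices hI : ∃ c : ℝ, ∀ x ∈ Ioo (0 : ℝ) 1, u x = c * binaryEntropy α x by
    obtain ⟨c, hc⟩ := hI
    refine ⟨c, fun x hx => ?_⟩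
    rcases hx.1.eq_or_lt with rfl | h0
    · rw [h.map_zero hα, binaryEntropy_zero hα, mul_zero]
    rcases hx.2.eq_or_lt with rfl | h1
    · rw [h.map_one hα, binaryEntropy_one hα, mul_zero]
    exact hc x ⟨h0, h1⟩
  by_cases h1 : α = 1
  · subst h1
    obtain ⟨κ, hκ⟩ := hF.eq_log_of_symm hw hs
    refine ⟨-κ, fun x hx => ?_⟩
    rw [← homogeneousExtension_one_sub 1 u x, hκ _ _ hx.1 (sub_pos.2 hx.2), binaryEntropy,
      if_pos rfl, add_sub_cancel, Real.log_one]
    ring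
  · refine ⟨-(homogeneousExtension α u 1 1 / (2 ^ α - 2)) * (1 - α), fun x hx => ?_⟩
    have h2 : 1 - α ≠ 0 := fun h' => h1 (by linarith)
    rw [← homogeneousExtension_one_sub α u x,
      hF.eq_rpow_of_ne_one h1 hs hx.1 (sub_pos.2 hx.2), binaryEntropy, if_neg h1,
      add_sub_cancel, Real.one_rpow, mul_assoc,
      ← mul_assoc (1 - α), mul_one_div_cancel h2]
    ring

/-! ### From the simplex to the unit interval -/

theorem eq_simplexPair (p : stdSimplex ℝ (Fin 2)) (x y : ℝ) (hx : 0 ≤ x) (hy : 0 ≤ y)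
    (hxy : x + y = 1) (h : p.1 0 = x) : p = simplexPair x y hx hy hxy := by
  have hp : p.1 0 + p.1 1 = 1 := by rw [← Fin.sum_univ_two]; exact p.2.2
  refine Subtype.ext (funext fun i => ?_)
  fin_cases i
  · exact h
  · show p.1 1 = y
    linarith

/-- The function `x ↦ f (x, 1 - x)` on `[0,1]`, extended by `0`. -/
noncomputable def unitFunction (f : stdSimplex ℝ (Fin 2) → ℝ) (x : ℝ) : ℝ :=
  if h : x ∈ Icc (0 : ℝ) 1 then
    f (simplexPair x (1 - x) h.1 (sub_nonneg.2 h.2) (add_sub_cancel x 1))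
  else 0

theorem unitFunction_apply (f : stdSimplex ℝ (Fin 2) → ℝ) (p : stdSimplex ℝ (Fin 2)) :
    f p = unitFunction f (p.1 0) := by
  have h : p.1 0 ∈ Icc (0 : ℝ) 1 := mem_Icc_of_mem_stdSimplex p.2 0
  rw [unitFunction, dif_pos h, ← eq_simplexPair p _ _ _ _ _ rfl]

theorem unitFunction_simplexPair (f : stdSimplex ℝ (Fin 2) → ℝ) (x y : ℝ) (hx : 0 ≤ x)
    (hy : 0 ≤ y) (hxy : x + y = 1) : f (simplexPair x y hx hy hxy) = unitFunction f x :=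
  unitFunction_apply f _

theorem aemeasurable_unitFunction {f : stdSimplex ℝ (Fin 2) → ℝ} (hf : LebesgueMeasurable f) :
    AEMeasurable (unitFunction f) (volume.restrict (Icc (0 : ℝ) 1)) := by
  refine (aemeasurable_restrict_iff_comap_subtype measurableSet_Icc).2 ?_
  have h : unitFunction f ∘ ((↑) : Icc (0 : ℝ) 1 → ℝ) = fun x : unitInterval =>
      f (simplexPair x (1 - x) x.2.1 (sub_nonneg.2 x.2.2) (add_sub_cancel (x : ℝ) 1)) :=
    funext fun x => dif_pos x.2
  rw [h]
  exact hf

theorem TwistedCocycle.unitFunction_eq {α : ℝ} {f₁ f₂ : stdSimplex ℝ (Fin 2) → ℝ}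
    (h : TwistedCocycle α f₁ f₂) {x y : ℝ} (hx0 : 0 ≤ x) (hx1 : x < 1) (hy0 : 0 ≤ y)
    (hy1 : y < 1) (hxy : x + y ≤ 1) :
    (1 - y) ^ α * unitFunction f₁ ((1 - x - y) / (1 - y)) - unitFunction f₁ (1 - x) =
      (1 - x) ^ α * unitFunction f₂ ((1 - x - y) / (1 - x)) - unitFunction f₂ (1 - y) := by
  have hp : ![1 - x - y, x, y] ∈ stdSimplex ℝ (Fin 3) := by
    refine ⟨fun i => ?_, by simp [Fin.sum_univ_three]; ring⟩
    fin_cases i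
    · show 0 ≤ 1 - x - y
      linarith
    · exact hx0
    · exact hy0
  have e := h _ hp
  have k1 : ![1 - x - y, x, y] 1 < 1 := hx1
  have k2 : ![1 - x - y, x, y] 2 < 1 := hy1
  rw [twistedTerm, twistedTerm, dif_pos k2, dif_pos k1, binaryMarginal, binaryMarginal] at e
  simp only [unitFunction_simplexPair] at e
  exact e

/-- The two components of a twisted cocycle are exchanged by the transposition. -/
theorem TwistedCocycle.unitFunction_swap {α : ℝ} {f₁ f₂ : stdSimplex ℝ (Fin 2) → ℝ}
    (h : TwistedCocycle α f₁ f₂) (h₁ : VanishesAtVertices f₁) (h₂ : VanishesAtVertices f₂)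
    {x : ℝ} (hx : x ∈ Icc (0 : ℝ) 1) : unitFunction f₂ x = unitFunction f₁ (1 - x) := by
  have z1 : unitFunction f₁ 0 = 0 :=
    (unitFunction_simplexPair f₁ 0 1 _ _ _).symm.trans h₁.1
  have o1 : unitFunction f₁ 1 = 0 :=
    (unitFunction_simplexPair f₁ 1 0 _ _ _).symm.trans h₁.2
  have z2 : unitFunction f₂ 0 = 0 :=
    (unitFunction_simplexPair f₂ 0 1 _ _ _).symm.trans h₂.1
  have o2 : unitFunction f₂ 1 = 0 :=
    (unitFunction_simplexPair f₂ 1 0 _ _ _).symm.trans h₂.2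
  rcases hx.1.eq_or_lt with rfl | h0
  · rw [sub_zero, o1, z2]
  rcases hx.2.eq_or_lt with rfl | h1
  · rw [sub_self, z1, o2]
  -- With `y = 1 - x` the point lies on the edge `p₀ = 0`, where both twisted terms are values at a
  -- vertex.
  have := h.unitFunction_eq hx.1 h1 (y := 1 - x) (by linarith) (by linarith) (by linarith)
  simp only [sub_self, zero_div, sub_sub_cancel, z1, z2, mul_zero, zero_sub] at this
  linarith

theorem TwistedCocycle.fundamentalEquation {α : ℝ} {f₁ f₂ : stdSimplex ℝ (Fin 2) → ℝ}
    (h : TwistedCocycle α f₁ f₂) (h₁ : VanishesAtVertices f₁) (h₂ : VanishesAtVertices f₂) :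
    FundamentalEquation α (unitFunction f₁) := by
  intro x y hx0 hx1 hy0 hy1 hxy
  have hx : 0 < 1 - x := by linarith
  have e := h.unitFunction_eq hx0 hx1 hy0 hy1 hxy
  rw [h.unitFunction_swap h₁ h₂ (x := (1 - x - y) / (1 - x))
      ⟨div_nonneg (by linarith) hx.le, by rw [div_le_one hx]; linarith⟩,
    h.unitFunction_swap h₁ h₂ (x := 1 - y) ⟨by linarith, by linarith⟩, sub_sub_cancel,
    show 1 - (1 - x - y) / (1 - x) = y / (1 - x) by field_simp; ring] at e
  linarith

theorem binaryEntropy_one_sub (α x : ℝ) : binaryEntropy α (1 - x) = binaryEntropy α x := by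
  unfold binaryEntropy
  rw [sub_sub_cancel]
  split_ifs <;> ring

theorem mainTheorem2 (α : ℝ) (hα : 0 < α) :
    (∀ f₁ f₂ : stdSimplex ℝ (Fin 2) → ℝ,
      LebesgueMeasurable f₁ → LebesgueMeasurable f₂ →
      VanishesAtVertices f₁ → VanishesAtVertices f₂ → TwistedCocycle α f₁ f₂ →
      f₁ = f₂ ∧ ∃ c : ℝ, ∀ p : stdSimplex ℝ (Fin 2), f₁ p = c * binaryEntropy α (p.1 0)) ∧
    (∀ u : ℝ → ℝ,
      (AEMeasurable u (volume.restrict (Icc (0 : ℝ) 1)) ∧ FundamentalEquation α u ∧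
        u 0 = 0 ∧ u 1 = 0) ↔
      ∃ c : ℝ, ∀ x ∈ Icc (0 : ℝ) 1, u x = c * binaryEntropy α x) ∧
    (∀ u : ℝ → ℝ, AEMeasurable u (volume.restrict (Icc (0 : ℝ) 1)) →
      FundamentalEquation α u → ContDiffOn ℝ ∞ u (Ioo 0 1)) ∧
    (∀ u : ℝ → ℝ, FundamentalEquation α u →
      ∀ q : ℚ, (q : ℝ) ∈ Icc (0 : ℝ) 1 → u q = u (1 - q)) := by
  refine ⟨fun f₁ f₂ m₁ _ h₁ h₂ h => ?_, fun u => ⟨fun ⟨hu, h, _⟩ => h.eq_mul_binaryEntropy hα hu,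
    fun ⟨c, hc⟩ => ⟨?_, (fundamentalEquation_binaryEntropy hα).const_mul_of_eqOn hc, ?_, ?_⟩⟩,
    fun u hu h => ?_, fun u h => h.symm_ratCast hα⟩
  · obtain ⟨c, hc⟩ := (h.fundamentalEquation h₁ h₂).eq_mul_binaryEntropy hα
      (aemeasurable_unitFunction m₁)
    refine ⟨funext fun p => ?_, c, fun p => ?_⟩
    · have hp : p.1 0 ∈ Icc (0 : ℝ) 1 := mem_Icc_of_mem_stdSimplex p.2 0
      rw [unitFunction_apply f₁, unitFunction_apply f₂, h.unitFunction_swap h₁ h₂ hp, hc _ hp,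
        hc _ ⟨sub_nonneg.2 hp.2, sub_le_self _ hp.1⟩, binaryEntropy_one_sub]
    · rw [unitFunction_apply f₁, hc _ (mem_Icc_of_mem_stdSimplex p.2 0)]
  · exact ((measurable_binaryEntropy α).const_mul c).aemeasurable.congr
      ((ae_restrict_iff' measurableSet_Icc).2 (.of_forall fun x hx => (hc x hx).symm))
  · rw [hc 0 ⟨le_rfl, zero_le_one⟩, binaryEntropy_zero hα, mul_zero]
  · rw [hc 1 ⟨zero_le_one, le_rfl⟩, binaryEntropy_one hα, mul_zero]
  · obtain ⟨c, hc⟩ := h.eq_mul_binaryEntropy hα hu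
    exact (contDiffOn_const.mul (contDiffOn_binaryEntropy α)).congr
      fun x hx => hc x (Ioo_subset_Icc_self hx)
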